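/- Fix $c>0$, a convex Lipschitz function $g\colon[0,\infty)\to[0,\infty)$, and positive reals $\zeta_1,\zeta_2,\dots$ with $\zeta_n\to 0$ and $\liminf_{n\to\infty} n\zeta_n^2/\log n>16c$. Let $B$ be a standard Brownian motion, $G(t)=\exp(\sqrt c\,B(t)-ct/2)$ for $0\le t\le 1$, and let $\beta=\mathbb E[g(G(1))]$ be the Black–Scholes price. For $n\ge 1$ let $\mathcal X^n$ be the set of stochastic processes $X=(X(t))_{0\le t\le 1}$ with continuous paths, values in $[0,\infty)$ and $X(0)=1$ such that (i) for all $0\le s\le t\le 1$, $(X(t)-X(s))^2$ is integrable and $\mathbb E[(X(t)-X(s))^2\mid\mathcal F_s]\le(\exp(c(t-s))-1)\,X(s)^2$ a.s., where $\mathcal F_s=\sigma(X(r):0\le r\le s)$; (ii) almost surely, $X(m/n)>0$ for $0\le m\le n$ and $\left|\frac{X((m+1)/n)}{X(m/n)}-1\right|\le\zeta_n$ for $0\le m\le n-1$. Let $\mathcal A_n$ be the set of investor strategies $A=(A_1,\dots,A_n)$, where $A_m$ is a real-valued measurable function of the price path restricted to $[0,(m-1)/n]$. For $A\in\mathcal A_n$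 and $X\in\mathcal X^n$ put $\Delta_m=A_m\big(X|_{[0,(m-1)/n]}\big)$ and $$L_n(A,X)=\mathbb E\Big[g(X(1))-\sum_{m=1}^n\Big(\frac{X(m/n)}{X((m-1)/n)}-1\Big)\Delta_m\Big]\in[-\infty,\infty],$$ where the expectation is the difference of the expectations of the positive and the negative part, read as $-\infty$ if both are infinite (so that such a pair does not contribute to a supremum over $X$). Then $$\beta\;\le\;\liminf_{n\to\infty}\ \inf_{A\in\mathcal A_n}\ \sup_{X\in\mathcal X^n}L_n(A,X).$$ In particular, $\beta$ is at most the limit of the minimax game values whenever that limit exists. -/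

import Mathlib

open MeasureTheory ProbabilityTheory Filter Topology
open scoped NNReal ENNReal unitInterval

noncomputable section

namespace OptionGame

/-- The time `m / n` in `[0,1]`, for `0 ≤ m ≤ n`. -/
def gridTime (n : ℕ) (m : Fin (n + 1)) : I :=
  ⟨(m : ℝ) / n, by positivity,
    div_le_one_of_le₀ (by exact_mod_cast Nat.lt_succ_iff.mp m.isLt) (by positivity)⟩

/-- A continuous stochastic price process on `[0,1]` with values in `[0,∞)` and initial price `1`,
defined on an arbitrary probability space. -/
structure PriceProcess where
  Ω : Type
  [mΩ : MeasurableSpace Ω]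
  P : Measure Ω
  [isProb : IsProbabilityMeasure P]
  path : Ω → C(I, ℝ)
  measurable_eval : ∀ t : I, Measurable fun ω => path ω t
  nonneg : ∀ ω t, 0 ≤ path ω t
  start : ∀ ω, path ω 0 = 1

attribute [instance] PriceProcess.mΩ PriceProcess.isProb

/-- The filtration generated by the price process. -/
def PriceProcess.history (X : PriceProcess) : Filtration I X.mΩ :=
  Filtration.natural (fun t ω => X.path ω t) fun t => (X.measurable_eval t).stronglyMeasurable

/-- The continuous variance constraint with variance parameter `c`:
`E[(X t - X s)² ∣ F s] ≤ (exp (c (t - s)) - 1) (X s)²` almost surely, for all `0 ≤ s ≤ t ≤ 1`.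
Integrability is stated because `condExp` has the junk value `0` without it. -/
def PriceProcess.ContinuousVarianceConstraint (c : ℝ) (X : PriceProcess) : Prop :=
  ∀ s t : I, s ≤ t →
    Integrable (fun ω => (X.path ω t - X.path ω s) ^ 2) X.P ∧
    X.P[fun ω => (X.path ω t - X.path ω s) ^ 2 | X.history s] ≤ᵐ[X.P]
      fun ω => (Real.exp (c * ((t : ℝ) - (s : ℝ))) - 1) * (X.path ω s) ^ 2

/-- The `z`-constraint on the prices at the times `0, 1/n, …, n/n`: these prices are positive
(so that the ratios make sense) and consecutive ratios differ from `1` by at most `z`,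
almost surely. -/
def PriceProcess.RatioConstraint (n : ℕ) (z : ℝ) (X : PriceProcess) : Prop :=
  (∀ m : Fin (n + 1), ∀ᵐ ω ∂X.P, 0 < X.path ω (gridTime n m)) ∧
  ∀ m : Fin n, ∀ᵐ ω ∂X.P,
    |X.path ω (gridTime n m.succ) / X.path ω (gridTime n m.castSucc) - 1| ≤ z

/-- Nature's strategy set in the game with `n` rounds. -/
def naturePaths (c : ℝ) (ζ : ℕ → ℝ) (n : ℕ) : Set PriceProcess :=
  {X | X.ContinuousVarianceConstraint c ∧ X.RatioConstraint n (ζ n)}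

/-- The σ-algebra on path space generated by the path restricted to `[0,t]`. -/
@[reducible] def observed (t : I) : MeasurableSpace C(I, ℝ) :=
  ⨆ s : I, ⨆ _ : s ≤ t, MeasurableSpace.comap (fun x : C(I, ℝ) => x s) (borel ℝ)

/-- An investor's strategy in the game with `n` rounds. With rounds numbered `m = 0, …, n - 1`,
the amount invested in round `m`, during `[m/n, (m+1)/n]`, is a measurable
function of the price path up to time `m/n`. -/
structure InvestorStrategy (n : ℕ) where
  invest : Fin n → C(I, ℝ) → ℝ
  measurable_invest : ∀ m : Fin n, Measurable[observed (gridTime n m.castSucc)] (invest m)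

/-- The expectation `E[f⁺] - E[f⁻]` in `[-∞,∞]`. When both terms are infinite, the
conventions of `EReal` give `-∞`, so that such a case never contributes to a supremum. -/
def extendedExpectation {Ω : Type*} [MeasurableSpace Ω] (P : Measure Ω) (f : Ω → ℝ) : EReal :=
  ((∫⁻ ω, ENNReal.ofReal (f ω) ∂P : ℝ≥0∞) : EReal) -
    ((∫⁻ ω, ENNReal.ofReal (-f ω) ∂P : ℝ≥0∞) : EReal)

/-- The expected option payoff minus the investor's earnings. -/
def loss (g : ℝ → ℝ) {n : ℕ} (A : InvestorStrategy n) (X : PriceProcess) : EReal :=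
  extendedExpectation X.P fun ω =>
    g (X.path ω 1) - ∑ m : Fin n,
      (X.path ω (gridTime n m.succ) / X.path ω (gridTime n m.castSucc) - 1) *
        A.invest m (X.path ω)

/-- The minimax value of the game with `n` rounds. -/
def gameValue (g : ℝ → ℝ) (c : ℝ) (ζ : ℕ → ℝ) (n : ℕ) : EReal :=
  ⨅ A : InvestorStrategy n, ⨆ X ∈ naturePaths c ζ n, loss g A X

/-- Geometric Brownian motion with drift `0` and volatility `√c`, driven by `B`. -/
def geometricBrownian {Ω : Type*} (c : ℝ) (B : ℝ≥0 → Ω → ℝ) (t : ℝ≥0) (ω : Ω) : ℝ :=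
  Real.exp (√c * B t ω - c * t / 2)

/-- The Black-Scholes price `E[g (G 1)]`. -/
def blackScholesPrice {Ω : Type*} [MeasurableSpace Ω] (P : Measure Ω) (g : ℝ → ℝ) (c : ℝ)
    (B : ℝ≥0 → Ω → ℝ) : ℝ :=
  ∫ ω, g (geometricBrownian c B 1 ω) ∂P

end OptionGame

end

/-! Nature can play a binomial tree: in each of the `n` periods the price is multiplied by `1 + a`
or `1 - a` according to a fair coin, with linear interpolation inside the period. Against this
martingale every investor earns `0` on average (`loss_tree`), so the value of the game is at least
`E[g(X(1))]` (`le_gameValue`). The logarithm of `X(1)` is a sum of `n` i.i.d. terms and converges in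
law to `N(-c/2, c)`, the law of `log G(1)` (`tendsto_logPriceLaw`). As `g ≥ 0` is continuous,
Fatou's lemma for weak convergence bounds the liminf of `E[g(X(1))]` below by the Black–Scholes
price (`blackScholesPrice_le_liminf`).

The delicate point is that the tree is admissible at all pairs of times. Inside a period the path
already reveals the sign of the move. After a partial rise, the rest of the rise is certain, and
later steps act on a price that may be almost `1 + a` times the present one. The bound
`variance_scalar_bound` therefore needs `n (a (1 + a))^2 ≤ c`, not just `n a^2 ≤ c`. Hence the
choice `a = q / (1 + q)` with `q = √(c / n)`, which still gives `√n a → √c`. -/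

noncomputable section

namespace OptionGame

/-! ### Independent fair signs -/

/-- The sign encoded by a Boolean. -/
def sign (b : Bool) : ℝ := if b then 1 else -1

lemma sign_eq_or (b : Bool) : sign b = 1 ∨ sign b = -1 := by cases b <;> simp [sign]

/-- The uniform distribution on sequences of `n` Booleans. -/
def fairCoins (n : ℕ) : Measure (Fin n → Bool) :=
  (PMF.uniformOfFintype (Fin n → Bool)).toMeasure

instance (n : ℕ) : IsProbabilityMeasure (fairCoins n) := by
  unfold fairCoins; infer_instance

lemma integral_fairCoins {E : Type*} [NormedAddCommGroup E] [NormedSpace ℝ E] [CompleteSpace E]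
    {n : ℕ} (f : (Fin n → Bool) → E) :
    ∫ ω, f ω ∂(fairCoins n) = ((2 : ℝ) ^ n)⁻¹ • ∑ ω, f ω := by
  rw [fairCoins, PMF.integral_eq_sum, Finset.smul_sum]
  simp

lemma integrable_fairCoins {E : Type*} [NormedAddCommGroup E] {n : ℕ}
    (f : (Fin n → Bool) → E) : Integrable f (fairCoins n) := .of_finite

/-- Flipping coin `j` permutes the sample space and leaves `ψ` unchanged, so `r` may be averaged
over the two faces. -/
lemma integral_mul_coin {𝕜 : Type*} [RCLike 𝕜] {n : ℕ} (j : Fin n)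
    {ψ : (Fin n → Bool) → 𝕜} (hψ : DependsOn ψ ({j}ᶜ : Set (Fin n))) (r : Bool → 𝕜) :
    ∫ ω, ψ ω * r (ω j) ∂(fairCoins n) =
      (∫ ω, ψ ω ∂(fairCoins n)) * ((r true + r false) / 2) := by
  have hflip : Function.Involutive
      fun ω : Fin n → Bool => Function.update ω j (!(ω j)) := fun ω => by simp
  have h1 : ∑ ω, ψ ω * r (ω j) = ∑ ω, ψ ω * r (!(ω j)) := by
    rw [← Equiv.sum_comp hflip.toPerm]
    refine Finset.sum_congr rfl fun ω _ => ?_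
    have : ψ (Function.update ω j (!(ω j))) = ψ ω := hψ fun i hi => by
      simp [Function.update_of_ne (show i ≠ j from hi)]
    simp [this]
  have h2 : ∑ ω, ψ ω * r (ω j) + ∑ ω, ψ ω * r (!(ω j)) = (∑ ω, ψ ω) * (r true + r false) := by
    rw [← Finset.sum_add_distrib, Finset.sum_mul]
    refine Finset.sum_congr rfl fun ω _ => ?_
    cases ω j <;> simp <;> ring
  have h3 : ∑ ω, ψ ω * r (ω j) = (∑ ω, ψ ω) * ((r true + r false) / 2) := by
    rw [← h1] at h2
    linear_combination h2 / 2
  rw [integral_fairCoins, integral_fairCoins, h3, smul_mul_assoc]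

lemma integral_mul_prod_coin {𝕜 : Type*} [RCLike 𝕜] {n : ℕ} (r : Fin n → Bool → 𝕜)
    (T : Finset (Fin n)) {ψ : (Fin n → Bool) → 𝕜}
    (hψ : DependsOn ψ ((T : Set (Fin n))ᶜ)) :
    ∫ ω, ψ ω * ∏ i ∈ T, r i (ω i) ∂(fairCoins n) =
      (∫ ω, ψ ω ∂(fairCoins n)) * ∏ i ∈ T, (r i true + r i false) / 2 := by
  induction T using Finset.induction_on with
  | empty => simp
  | insert j T hj ih =>
    have hdep : DependsOn (fun ω => ψ ω * ∏ i ∈ T, r i (ω i)) ({j}ᶜ : Set (Fin n)) := by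
      intro x y hxy
      have hprod : ∏ i ∈ T, r i (x i) = ∏ i ∈ T, r i (y i) :=
        Finset.prod_congr rfl fun i hi => by
          rw [hxy i (by rintro rfl; exact hj hi)]
      have : ψ x = ψ y := hψ fun i hi => hxy i fun h => hi (by simp [Set.mem_singleton_iff.mp h])
      simp only [hprod, this]
    have hsub : DependsOn ψ ((T : Set (Fin n))ᶜ) := hψ.mono (by simp)
    calc ∫ ω, ψ ω * ∏ i ∈ insert j T, r i (ω i) ∂(fairCoins n)
        = ∫ ω, (ψ ω * ∏ i ∈ T, r i (ω i)) * r j (ω j) ∂(fairCoins n) := by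
          congr 1 with ω
          rw [Finset.prod_insert hj]
          ring
      _ = _ := by
          rw [integral_mul_coin j hdep, ih hsub, Finset.prod_insert hj]
          ring

/-! ### Conditional expectations and σ-algebras generated by restrictions -/

lemma condExp_le_of_forall_setIntegral_le {Ω : Type*} {m m0 : MeasurableSpace Ω}
    {μ : Measure Ω} [IsFiniteMeasure μ] (hm : m ≤ m0) {f h : Ω → ℝ} (hf : Integrable f μ)
    (hh : Integrable h μ) (hhm : StronglyMeasurable[m] h)
    (hle : ∀ S, MeasurableSet[m] S → ∫ ω in S, f ω ∂μ ≤ ∫ ω in S, h ω ∂μ) :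
    μ[f | m] ≤ᵐ[μ] h := by
  refine ae_le_of_ae_le_trim (hm := hm) (ae_le_of_forall_setIntegral_le
    (integrable_condExp.trim hm stronglyMeasurable_condExp) (hh.trim hm hhm) fun S hS _ => ?_)
  rw [← setIntegral_trim hm stronglyMeasurable_condExp hS, ← setIntegral_trim hm hhm hS,
    setIntegral_condExp hm hf hS]
  exact hle S hS

/-- The generated σ-algebra lies inside the pullback, along the restriction to the indices in `p`,
of the full power set. A set of that pullback cannot separate points with equal restrictions. -/
lemma mem_iff_of_iSup_comap {Ω ι E : Type*} [mE : MeasurableSpace E] {p : ι → Prop}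
    {Y : ι → Ω → E} {S : Set Ω} (hS : MeasurableSet[⨆ i, ⨆ _ : p i, mE.comap (Y i)] S)
    {x y : Ω} (hxy : ∀ i, p i → Y i x = Y i y) : x ∈ S ↔ y ∈ S := by
  have hle : (⨆ i, ⨆ _ : p i, mE.comap (Y i)) ≤
      MeasurableSpace.comap (fun ω (i : {i // p i}) => Y i ω) ⊤ := by
    refine iSup₂_le fun i hi => ?_
    rintro _ ⟨T, -, rfl⟩
    exact ⟨{z | z ⟨i, hi⟩ ∈ T}, trivial, rfl⟩
  obtain ⟨T, -, rfl⟩ := hle S hS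
  have : (fun i : {i // p i} => Y i x) = fun i : {i // p i} => Y i y := funext fun i => hxy i i.2
  simp only [Set.mem_preimage, this]

lemma InvestorStrategy.invest_congr {n : ℕ} (A : InvestorStrategy n) (m : Fin n)
    {x y : C(I, ℝ)} (hxy : ∀ t ≤ gridTime n m.castSucc, x t = y t) :
    A.invest m x = A.invest m y := by
  have hS := A.measurable_invest m (measurableSet_singleton (A.invest m y))
  exact (mem_iff_of_iSup_comap (mE := borel ℝ) (Y := fun (t : I) (x : C(I, ℝ)) => x t)
    hS hxy).2 rfl

lemma PriceProcess.mem_iff_of_measurableSet_history (X : PriceProcess) {s : I} {S : Set X.Ω}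
    (hS : MeasurableSet[X.history s] S) {x y : X.Ω} (hxy : ∀ t ≤ s, X.path x t = X.path y t) :
    x ∈ S ↔ y ∈ S := by
  exact mem_iff_of_iSup_comap (mE := borel ℝ) (Y := fun (t : I) ω => X.path ω t) hS hxy

lemma extendedExpectation_eq_integral {Ω : Type*} [MeasurableSpace Ω] {P : Measure Ω}
    {f : Ω → ℝ} (hf : Integrable f P) :
    extendedExpectation P f = ((∫ ω, f ω ∂P : ℝ) : EReal) := by
  have h1 : ∫⁻ ω, ENNReal.ofReal (f ω) ∂P ≠ ∞ := hf.lintegral_lt_top.ne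
  have h2 : ∫⁻ ω, ENNReal.ofReal (-f ω) ∂P ≠ ∞ := hf.neg.lintegral_lt_top.ne
  rw [extendedExpectation, integral_eq_lintegral_pos_part_sub_lintegral_neg_part hf,
    EReal.coe_sub, EReal.coe_ennreal_toReal h1, EReal.coe_ennreal_toReal h2]

/-! ### Scalar inequalities -/

/-- Bernoulli's inequality for `(exp y) ^ l`. -/
lemma mul_exp_sub_one_le {l y : ℝ} (hl : 1 ≤ l) (hy : 0 ≤ y) :
    l * (Real.exp y - 1) ≤ Real.exp (l * y) - 1 := by
  have := one_add_mul_self_le_rpow_one_add (s := Real.exp y - 1)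
    (by linarith [Real.one_le_exp hy]) hl
  rw [add_sub_cancel, ← Real.exp_mul, mul_comm y l] at this
  linarith

/-- The variance bound between two times of which the first is followed by a partial step, from
`p` to `r`, of known sign `e`, and then by independent steps with total variance factor `v`. -/
lemma variance_scalar_bound {a k p r e W v : ℝ} (ha : 0 ≤ a) (ha' : a ≤ 1 / 2)
    (hak : (a * (1 + a)) ^ 2 ≤ k) (hp : 0 ≤ p) (hpr : p ≤ r) (hr : r ≤ 1)
    (he : e = 1 ∨ e = -1) (hW : 0 ≤ W) (hv : v ≤ Real.exp (a ^ 2 * W)) :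
    (1 + a * e * r) ^ 2 * v - 2 * (1 + a * e * p) * (1 + a * e * r) + (1 + a * e * p) ^ 2 ≤
      (Real.exp (k * (r - p + W)) - 1) * (1 + a * e * p) ^ 2 := by
  have hak' : a ^ 2 ≤ k := le_trans (by nlinarith [sq_nonneg a, mul_nonneg ha (sq_nonneg a)]) hak
  have hk : 0 ≤ k := (sq_nonneg _).trans hak'
  have hδ : 0 ≤ r - p := sub_nonneg.2 hpr
  have hexp : k * (r - p) + (Real.exp (k * W) - 1) ≤ Real.exp (k * (r - p + W)) - 1 := by
    rw [mul_add, Real.exp_add]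
    have h1 := Real.add_one_le_exp (k * (r - p))
    have h2 := Real.one_le_exp (mul_nonneg hk hW)
    have h3 := mul_nonneg hk hδ
    nlinarith
  -- For `e = -1`, `a ≤ 1/2` gives `(1 - a p)^2 ≥ 1 - 2 a p ≥ 1 - p`. Since `r - p ≤ 1 - p`, the
  -- quadratic term `a^2 (r - p)^2` of the known move is then covered by the linear term `k (r - p)`
  -- of `hexp`.
  have hap : 1 - p ≤ (1 + a * e * p) ^ 2 := by
    rcases he with rfl | rfl
    · nlinarith [mul_nonneg ha hp, sq_nonneg (a * p)]
    · nlinarith [mul_nonneg hp (sub_nonneg.2 ha'), sq_nonneg (a * p)]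
  have hstep : a ^ 2 * (r - p) ^ 2 ≤ k * (r - p) * (1 + a * e * p) ^ 2 := by
    have h1 : r - p ≤ (1 + a * e * p) ^ 2 := by linarith
    calc a ^ 2 * (r - p) ^ 2 = a ^ 2 * (r - p) * (r - p) := by ring
      _ ≤ k * (r - p) * (1 + a * e * p) ^ 2 := by gcongr
  have hpos : 0 ≤ Real.exp (a ^ 2 * W) - 1 := by
    linarith [Real.one_le_exp (mul_nonneg (sq_nonneg a) hW)]
  have htail : (1 + a * e * r) ^ 2 * (Real.exp (a ^ 2 * W) - 1) ≤
      (Real.exp (k * W) - 1) * (1 + a * e * p) ^ 2 := by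
    have hle : Real.exp (a ^ 2 * W) ≤ Real.exp (k * W) := by gcongr
    have har : a * r ≤ a := by nlinarith
    have hapr : a * p ≤ a * r := by gcongr
    have hap0 : 0 ≤ a * p := by positivity
    rcases he with rfl | rfl
    -- Bernoulli moves the factor `(1 + a)^2` into the exponent, where `hak` absorbs it.
    · calc (1 + a * 1 * r) ^ 2 * (Real.exp (a ^ 2 * W) - 1)
          ≤ (1 + a) ^ 2 * (Real.exp (a ^ 2 * W) - 1) := by
            gcongr <;> linarith
        _ ≤ Real.exp ((1 + a) ^ 2 * (a ^ 2 * W)) - 1 :=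
            mul_exp_sub_one_le (by nlinarith) (by positivity)
        _ ≤ Real.exp (k * W) - 1 := by
            have : (1 + a) ^ 2 * (a ^ 2 * W) ≤ k * W := by
              calc (1 + a) ^ 2 * (a ^ 2 * W) = (a * (1 + a)) ^ 2 * W := by ring
                _ ≤ k * W := by gcongr
            linarith [Real.exp_le_exp.2 this]
        _ ≤ (Real.exp (k * W) - 1) * (1 + a * 1 * p) ^ 2 := by
            refine le_mul_of_one_le_right (by linarith) ?_
            nlinarith
    · rw [mul_comm]
      have : (1 + a * -1 * r) ^ 2 ≤ (1 + a * -1 * p) ^ 2 := by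
        have : 0 ≤ 1 + a * -1 * r := by linarith
        gcongr ?_ ^ 2
        linarith
      gcongr
      linarith
  have h1 := mul_le_mul_of_nonneg_left hv (sq_nonneg (1 + a * e * r))
  have h2 := mul_le_mul_of_nonneg_right hexp (sq_nonneg (1 + a * e * p))
  have he2 : e ^ 2 = 1 := by rcases he with rfl | rfl <;> norm_num
  have hid : (1 + a * e * r) ^ 2 - 2 * (1 + a * e * p) * (1 + a * e * r) + (1 + a * e * p) ^ 2
      = a ^ 2 * (r - p) ^ 2 := by
    linear_combination (a ^ 2 * (r - p) ^ 2) * he2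
  nlinarith

/-! ### The interpolated binomial tree -/

/-- The elapsed fraction, at time `t`, of the `i`-th of `n` equal periods. -/
def elapsed (n : ℕ) (t : I) (i : Fin n) : ℝ := max 0 (min 1 (n * (t : ℝ) - i))

lemma elapsed_nonneg {n : ℕ} (t : I) (i : Fin n) : 0 ≤ elapsed n t i := le_max_left _ _

lemma elapsed_le_one {n : ℕ} (t : I) (i : Fin n) : elapsed n t i ≤ 1 :=
  max_le zero_le_one (min_le_left _ _)

lemma elapsed_mono {n : ℕ} {s t : I} (hst : s ≤ t) (i : Fin n) :
    elapsed n s i ≤ elapsed n t i := by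
  have : (s : ℝ) ≤ t := hst
  unfold elapsed
  gcongr

lemma sum_elapsed {n : ℕ} (t : I) : ∑ i : Fin n, elapsed n t i = n * (t : ℝ) := by
  -- The periods fill up in order, so the partial sums are clipped at `k`.
  have h (x : ℝ) (hx : 0 ≤ x) (k : ℕ) :
      ∑ i ∈ Finset.range k, max 0 (min 1 (x - i)) = min x k := by
    induction k with
    | zero => simp [hx]
    | succ k ih =>
      rw [Finset.sum_range_succ, ih]
      push_cast
      rcases le_total x k with h1 | h1
      · rw [min_eq_left h1, min_eq_left (by linarith : x ≤ k + 1), max_eq_left, add_zero]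
        exact min_le_of_right_le (by linarith)
      · rw [min_eq_right h1]
        rcases le_total x (k + 1) with h2 | h2
        · rw [min_eq_left h2, min_eq_right (by linarith), max_eq_right (by linarith)]
          ring
        · rw [min_eq_right h2, min_eq_left (by linarith), max_eq_right zero_le_one]
  have ht : n * (t : ℝ) ≤ n := mul_le_of_le_one_right (by positivity) t.2.2
  calc ∑ i : Fin n, elapsed n t i
      = ∑ i ∈ Finset.range n, max 0 (min 1 (n * (t : ℝ) - i)) :=
        Fin.sum_univ_eq_sum_range (fun i => max 0 (min 1 (n * (t : ℝ) - i))) n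
    _ = n * (t : ℝ) := by
        rw [h _ (mul_nonneg (by positivity) t.2.1), min_eq_left ht]

/-- A period cannot start before an earlier one is complete. -/
lemma le_of_elapsed {n : ℕ} {t : I} {i j : Fin n} (hi : 0 < elapsed n t i)
    (hj : elapsed n t j < 1) : i ≤ j := by
  have h1 : (0 : ℝ) < n * (t : ℝ) - i := by
    by_contra! h
    exact hi.ne' (max_eq_left (min_le_of_right_le h))
  have h2 : n * (t : ℝ) - j < 1 := by
    by_contra! h
    rw [elapsed, min_eq_left h, max_eq_right zero_le_one] at hj
    exact hj.false
  have h3 : (i : ℝ) < (j + 1 : ℕ) := by push_cast; linarith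
  exact Fin.le_def.2 (Nat.lt_succ_iff.1 (by exact_mod_cast h3))

lemma elapsed_gridTime {n : ℕ} (m : Fin (n + 1)) (i : Fin n) :
    elapsed n (gridTime n m) i = if (i : ℕ) < m then 1 else 0 := by
  have hn : (n : ℝ) ≠ 0 := by exact_mod_cast (i.pos).ne'
  have : n * ((gridTime n m : I) : ℝ) = m := by
    simp only [gridTime]
    field_simp
  rw [elapsed, this]
  split_ifs with h
  · have h' : ((i + 1 : ℕ) : ℝ) ≤ m := by exact_mod_cast h
    push_cast at h'
    rw [min_eq_left (by linarith), max_eq_right zero_le_one]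
  · have h' : ((m : ℕ) : ℝ) ≤ i := by exact_mod_cast not_lt.1 h
    exact max_eq_left (min_le_of_right_le (by linarith))

lemma elapsed_one {n : ℕ} (i : Fin n) : elapsed n 1 i = 1 := by
  have h : ((i + 1 : ℕ) : ℝ) ≤ n := by exact_mod_cast i.2
  push_cast at h
  simp only [elapsed, Set.Icc.coe_one, mul_one]
  rw [min_eq_left (by linarith), max_eq_right zero_le_one]

/-- The factor by which the `i`-th period has changed the price when the fraction `elapsed` of it
is over. -/
def stepFactor (n : ℕ) (a : ℝ) (t : I) (i : Fin n) (b : Bool) : ℝ :=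
  1 + a * sign b * elapsed n t i

lemma stepFactor_pos {n : ℕ} {a : ℝ} (ha : 0 ≤ a) (ha1 : a < 1) (t : I) (i : Fin n) (b : Bool) :
    0 < stepFactor n a t i b := by
  have h1 : a * elapsed n t i ≤ a := mul_le_of_le_one_right ha (elapsed_le_one t i)
  have h2 : 0 ≤ a * elapsed n t i := mul_nonneg ha (elapsed_nonneg t i)
  unfold stepFactor
  rcases sign_eq_or b with h | h <;> rw [h] <;> linarith

/-- The binomial tree with returns `±a` in each of `n` periods, interpolated linearly. -/
def treePath (n : ℕ) (a : ℝ) (ω : Fin n → Bool) : C(I, ℝ) where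
  toFun t := ∏ i, stepFactor n a t i (ω i)
  continuous_toFun := by
    unfold stepFactor elapsed
    fun_prop

lemma treePath_apply {n : ℕ} (a : ℝ) (ω : Fin n → Bool) (t : I) :
    treePath n a ω t = ∏ i, stepFactor n a t i (ω i) := rfl

lemma treePath_pos {n : ℕ} {a : ℝ} (ha : 0 ≤ a) (ha1 : a < 1) (ω : Fin n → Bool) (t : I) :
    0 < treePath n a ω t :=
  treePath_apply a ω t ▸ Finset.prod_pos fun i _ => stepFactor_pos ha ha1 t i (ω i)

/-- The interpolated binomial tree as a price process. -/
def tree (n : ℕ) {a : ℝ} (ha : 0 ≤ a) (ha1 : a < 1) : PriceProcess where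
  Ω := Fin n → Bool
  P := fairCoins n
  path := treePath n a
  measurable_eval _ := measurable_of_finite _
  nonneg ω t := (treePath_pos ha ha1 ω t).le
  start ω := by
    rw [treePath_apply]
    refine Finset.prod_eq_one fun i _ => ?_
    have : elapsed n 0 i = 0 := by simp [elapsed]
    simp [stepFactor, this]

lemma stepFactor_of_elapsed_eq_zero {n : ℕ} {a : ℝ} {t : I} {i : Fin n}
    (h : elapsed n t i = 0) (b : Bool) : stepFactor n a t i b = 1 := by
  simp [stepFactor, h]

lemma stepFactor_mean {n : ℕ} (a : ℝ) (t : I) (i : Fin n) :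
    (stepFactor n a t i true + stepFactor n a t i false) / 2 = 1 := by
  simp only [stepFactor, sign]
  norm_num
  ring

lemma stepFactor_sq_mean {n : ℕ} (a : ℝ) (t : I) (i : Fin n) :
    (stepFactor n a t i true ^ 2 + stepFactor n a t i false ^ 2) / 2 =
      1 + (a * elapsed n t i) ^ 2 := by
  simp only [stepFactor, sign]
  norm_num
  ring

/-- The periods that have started by time `s`. -/
def started (n : ℕ) (s : I) : Finset (Fin n) := {i | 0 < elapsed n s i}

lemma mem_started {n : ℕ} {s : I} {i : Fin n} : i ∈ started n s ↔ 0 < elapsed n s i := by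
  simp [started]

lemma elapsed_of_notMem_started {n : ℕ} {s : I} {i : Fin n} (h : i ∉ started n s) :
    elapsed n s i = 0 :=
  le_antisymm (not_lt.1 fun h' => h (mem_started.2 h')) (elapsed_nonneg s i)

lemma treePath_eq_prod_started {n : ℕ} (a : ℝ) (ω : Fin n → Bool) (s : I) :
    treePath n a ω s = ∏ i ∈ started n s, stepFactor n a s i (ω i) := by
  rw [treePath_apply]
  exact (Finset.prod_subset (Finset.subset_univ _) fun i _ hi =>
    stepFactor_of_elapsed_eq_zero (elapsed_of_notMem_started hi) _).symm

lemma treePath_congr {n : ℕ} (a : ℝ) {x y : Fin n → Bool} {s t : I} (hts : t ≤ s)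
    (hxy : ∀ i ∈ started n s, x i = y i) : treePath n a x t = treePath n a y t := by
  rw [treePath_apply, treePath_apply]
  refine Finset.prod_congr rfl fun i _ => ?_
  by_cases hi : i ∈ started n s
  · rw [hxy i hi]
  · have : elapsed n t i = 0 := le_antisymm
      ((elapsed_mono hts i).trans (elapsed_of_notMem_started hi).le) (elapsed_nonneg t i)
    rw [stepFactor_of_elapsed_eq_zero this, stepFactor_of_elapsed_eq_zero this]

/-- The effect by time `t` of the periods that have started by time `s`. -/
def startedFactor (n : ℕ) (a : ℝ) (s t : I) (ω : Fin n → Bool) : ℝ :=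
  ∏ i ∈ started n s, stepFactor n a t i (ω i)

lemma treePath_eq_startedFactor_mul {n : ℕ} (a : ℝ) (s t : I) (ω : Fin n → Bool) :
    treePath n a ω t =
      startedFactor n a s t ω * ∏ i ∈ (started n s)ᶜ, stepFactor n a t i (ω i) := by
  rw [treePath_apply, startedFactor, Finset.prod_mul_prod_compl]

lemma dependsOn_startedFactor {n : ℕ} (a : ℝ) (s t : I) :
    DependsOn (startedFactor n a s t) (started n s : Set (Fin n)) := fun x y hxy =>
  Finset.prod_congr rfl fun i hi => by rw [hxy i hi]

/-- The periods not yet started at `s` are independent of `φ` and their factors have mean `1`. -/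
lemma integral_mul_treePath {n : ℕ} (a : ℝ) (s t : I) {φ : (Fin n → Bool) → ℝ}
    (hφ : DependsOn φ (started n s : Set (Fin n))) :
    ∫ ω, φ ω * treePath n a ω t ∂(fairCoins n) =
      ∫ ω, φ ω * startedFactor n a s t ω ∂(fairCoins n) := by
  have hdep : DependsOn (fun ω => φ ω * startedFactor n a s t ω)
      (((started n s)ᶜ : Finset (Fin n)) : Set (Fin n))ᶜ := by
    rw [Finset.coe_compl, compl_compl]
    intro x y hxy
    simp only [hφ hxy, dependsOn_startedFactor a s t hxy]
  have := integral_mul_prod_coin (fun i => stepFactor n a t i) _ hdep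
  simp only [stepFactor_mean, Finset.prod_const_one, mul_one] at this
  rw [← this]
  congr 1 with ω
  rw [treePath_eq_startedFactor_mul a s t, mul_assoc]

lemma integral_mul_treePath_sq {n : ℕ} (a : ℝ) (s t : I) {φ : (Fin n → Bool) → ℝ}
    (hφ : DependsOn φ (started n s : Set (Fin n))) :
    ∫ ω, φ ω * treePath n a ω t ^ 2 ∂(fairCoins n) =
      ∫ ω, φ ω * (startedFactor n a s t ω ^ 2 *
        ∏ i ∈ (started n s)ᶜ, (1 + (a * elapsed n t i) ^ 2)) ∂(fairCoins n) := by
  have hdep : DependsOn (fun ω => φ ω * startedFactor n a s t ω ^ 2)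
      (((started n s)ᶜ : Finset (Fin n)) : Set (Fin n))ᶜ := by
    rw [Finset.coe_compl, compl_compl]
    intro x y hxy
    simp only [hφ hxy, dependsOn_startedFactor a s t hxy]
  have := integral_mul_prod_coin (fun i b => stepFactor n a t i b ^ 2) _ hdep
  simp only [stepFactor_sq_mean] at this
  simp_rw [← mul_assoc]
  rw [integral_mul_const, ← this]
  congr 1 with ω
  rw [treePath_eq_startedFactor_mul a s t, mul_pow, Finset.prod_pow, mul_assoc]

/-- At most one period is in progress at time `s`, with sign `e` and elapsed fractions `p` at `s`
and `r` at `t`. All other started periods are complete, and `V` is the product of their factors. -/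
lemma exists_current_step {n : ℕ} (a : ℝ) {s t : I} (hst : s ≤ t)
    (ω : Fin n → Bool) :
    ∃ e p r V : ℝ, (e = 1 ∨ e = -1) ∧ 0 ≤ p ∧ p ≤ r ∧ r ≤ 1 ∧
      treePath n a ω s = V * (1 + a * e * p) ∧
      startedFactor n a s t ω = V * (1 + a * e * r) ∧
      n * ((t : ℝ) - s) = r - p + ∑ i ∈ (started n s)ᶜ, elapsed n t i := by
  have hsum : n * ((t : ℝ) - s) = ∑ i ∈ started n s, (elapsed n t i - elapsed n s i) +
      ∑ i ∈ (started n s)ᶜ, elapsed n t i := by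
    have h : ∑ i ∈ (started n s)ᶜ, elapsed n t i =
        ∑ i ∈ (started n s)ᶜ, (elapsed n t i - elapsed n s i) :=
      Finset.sum_congr rfl fun i hi => by
        rw [elapsed_of_notMem_started (Finset.mem_compl.1 hi), sub_zero]
    rw [h, Finset.sum_add_sum_compl, Finset.sum_sub_distrib, sum_elapsed, sum_elapsed]
    ring
  have hfull {i : Fin n} (hi : ¬ elapsed n s i < 1) :
      elapsed n s i = 1 ∧ elapsed n t i = 1 := by
    have h1 := le_antisymm (elapsed_le_one s i) (not_lt.1 hi)
    exact ⟨h1, le_antisymm (elapsed_le_one t i) (h1 ▸ elapsed_mono hst i)⟩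
  by_cases h : ∃ j ∈ started n s, elapsed n s j < 1
  · obtain ⟨j, hj, hj1⟩ := h
    have hother {i : Fin n} (hi : i ∈ (started n s).erase j) :
        elapsed n s i = 1 ∧ elapsed n t i = 1 := by
      obtain ⟨hij, hi⟩ := Finset.mem_erase.1 hi
      exact hfull fun h => hij (le_antisymm (le_of_elapsed (mem_started.1 hi) hj1)
        (le_of_elapsed (mem_started.1 hj) h))
    refine ⟨sign (ω j), elapsed n s j, elapsed n t j,
      ∏ i ∈ (started n s).erase j, stepFactor n a s i (ω i), sign_eq_or _, elapsed_nonneg _ _,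
      elapsed_mono hst j, elapsed_le_one _ _, ?_, ?_, ?_⟩
    · rw [treePath_eq_prod_started, ← Finset.prod_erase_mul _ _ hj]
      rfl
    · rw [startedFactor, ← Finset.prod_erase_mul _ _ hj]
      congr 1
      refine Finset.prod_congr rfl fun i hi => ?_
      simp only [stepFactor, hother hi]
    · rw [hsum, ← Finset.sum_erase_add _ _ hj, Finset.sum_eq_zero fun i hi => by
        rw [(hother hi).1, (hother hi).2, sub_self], zero_add]
  · push Not at h
    have hfull' {i : Fin n} (hi : i ∈ started n s) := hfull (not_lt.2 (h i hi))
    -- No period is in progress: the sign is arbitrary and the partial move is empty.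
    refine ⟨1, 0, 0, treePath n a ω s, .inl rfl, le_rfl, le_rfl, zero_le_one, by simp, ?_, ?_⟩
    · rw [startedFactor, treePath_eq_prod_started, mul_zero, add_zero, mul_one]
      refine Finset.prod_congr rfl fun i hi => ?_
      simp only [stepFactor, hfull' hi]
    · rw [hsum, Finset.sum_eq_zero fun i hi => by
        rw [(hfull' hi).1, (hfull' hi).2, sub_self], sub_self]

/-! ### The conditional variance of the tree -/

lemma prod_one_add_elapsed_sq_le {n : ℕ} (a : ℝ) (t : I) (T : Finset (Fin n)) :
    ∏ i ∈ T, (1 + (a * elapsed n t i) ^ 2) ≤ Real.exp (a ^ 2 * ∑ i ∈ T, elapsed n t i) := by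
  rw [Finset.mul_sum, Real.exp_sum]
  refine Finset.prod_le_prod (fun i _ => by positivity) fun i _ => ?_
  have h1 : (a * elapsed n t i) ^ 2 ≤ a ^ 2 * elapsed n t i := by
    rw [mul_pow]
    gcongr
    exact pow_le_of_le_one (elapsed_nonneg t i) (elapsed_le_one t i) two_ne_zero
  linarith [Real.add_one_le_exp (a ^ 2 * elapsed n t i)]

/-- The left side is `E[(X(t) - X(s))^2 ∣ F_s]` expanded, with the unstarted periods averaged out.
After division by `V^2` it is `variance_scalar_bound` with `k = c / n`. -/
lemma tree_variance_pathwise {n : ℕ} (hn : 0 < n) {a c : ℝ} (ha : 0 ≤ a) (ha' : a ≤ 1 / 2)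
    (hac : n * (a * (1 + a)) ^ 2 ≤ c) {s t : I} (hst : s ≤ t) (ω : Fin n → Bool) :
    startedFactor n a s t ω ^ 2 * ∏ i ∈ (started n s)ᶜ, (1 + (a * elapsed n t i) ^ 2)
        - 2 * treePath n a ω s * startedFactor n a s t ω + treePath n a ω s ^ 2 ≤
      (Real.exp (c * ((t : ℝ) - s)) - 1) * treePath n a ω s ^ 2 := by
  obtain ⟨e, p, r, V, he, hp, hpr, hr, hX, hU, hts⟩ :=
    exists_current_step a hst ω
  have hn' : (0 : ℝ) < n := by exact_mod_cast hn
  have hk : (a * (1 + a)) ^ 2 ≤ c / n := by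
    rw [le_div_iff₀ hn']
    linarith
  have hct : c * ((t : ℝ) - s) = c / n * (r - p + ∑ i ∈ (started n s)ᶜ, elapsed n t i) := by
    rw [← hts]
    field_simp
  have h := variance_scalar_bound ha ha' hk hp hpr hr he
    (Finset.sum_nonneg fun i _ => elapsed_nonneg t i)
    (prod_one_add_elapsed_sq_le a t (started n s)ᶜ)
  have h' := mul_le_mul_of_nonneg_left h (sq_nonneg V)
  rw [hX, hU, hct]
  linarith

/-- The indicator of `S` depends only on the started periods, so the later coins can be integrated
out and the integrands compared pointwise. -/
lemma setIntegral_tree_variance_le {n : ℕ} (hn : 0 < n) {a c : ℝ} (ha : 0 ≤ a) (ha' : a ≤ 1 / 2)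
    (hac : n * (a * (1 + a)) ^ 2 ≤ c) {s t : I} (hst : s ≤ t) {S : Set (Fin n → Bool)}
    (hS : ∀ x y : Fin n → Bool, (∀ i ∈ started n s, x i = y i) → (x ∈ S ↔ y ∈ S)) :
    ∫ ω in S, (treePath n a ω t - treePath n a ω s) ^ 2 ∂(fairCoins n) ≤
      ∫ ω in S, (Real.exp (c * ((t : ℝ) - s)) - 1) * treePath n a ω s ^ 2 ∂(fairCoins n) := by
  set ψ : (Fin n → Bool) → ℝ := S.indicator 1 with hψdef
  have hψ0 (ω) : 0 ≤ ψ ω := Set.indicator_nonneg (fun _ _ => zero_le_one) ω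
  have hψ : DependsOn ψ (started n s : Set (Fin n)) := fun x y hxy => by
    rw [hψdef]
    by_cases hx : x ∈ S
    · rw [Set.indicator_of_mem hx, Set.indicator_of_mem ((hS x y hxy).1 hx)]
      rfl
    · rw [Set.indicator_of_notMem hx, Set.indicator_of_notMem (mt (hS x y hxy).2 hx)]
  have hset (f : (Fin n → Bool) → ℝ) :
      ∫ ω in S, f ω ∂(fairCoins n) = ∫ ω, ψ ω * f ω ∂(fairCoins n) := by
    rw [← integral_indicator S.toFinite.measurableSet]
    congr 1 with ω
    by_cases hx : ω ∈ S <;> simp [hψdef, hx]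
  have hψX : DependsOn (fun ω => ψ ω * treePath n a ω s) (started n s : Set (Fin n)) :=
    fun x y hxy => by
      simp only [hψ hxy, treePath_congr a le_rfl hxy]
  have h1 := integral_mul_treePath a s t hψX
  have h2 := integral_mul_treePath_sq a s t hψ
  rw [hset, hset]
  calc ∫ ω, ψ ω * (treePath n a ω t - treePath n a ω s) ^ 2 ∂(fairCoins n)
      = ∫ ω, ψ ω * treePath n a ω t ^ 2 ∂(fairCoins n)
        - 2 * ∫ ω, ψ ω * treePath n a ω s * treePath n a ω t ∂(fairCoins n)
        + ∫ ω, ψ ω * treePath n a ω s ^ 2 ∂(fairCoins n) := by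
        rw [← integral_const_mul, ← integral_sub (integrable_fairCoins _) (integrable_fairCoins _),
          ← integral_add (integrable_fairCoins _) (integrable_fairCoins _)]
        congr 1 with ω
        ring
    _ = ∫ ω, ψ ω * (startedFactor n a s t ω ^ 2 *
            ∏ i ∈ (started n s)ᶜ, (1 + (a * elapsed n t i) ^ 2)
          - 2 * treePath n a ω s * startedFactor n a s t ω + treePath n a ω s ^ 2)
          ∂(fairCoins n) := by
        rw [h1, h2, ← integral_const_mul,
          ← integral_sub (integrable_fairCoins _) (integrable_fairCoins _),
          ← integral_add (integrable_fairCoins _) (integrable_fairCoins _)]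
        congr 1 with ω
        ring
    _ ≤ _ := integral_mono (integrable_fairCoins _) (integrable_fairCoins _) fun ω =>
        mul_le_mul_of_nonneg_left (tree_variance_pathwise hn ha ha' hac hst ω) (hψ0 ω)

lemma tree_continuousVarianceConstraint {n : ℕ} (hn : 0 < n) {a c : ℝ} (ha : 0 ≤ a)
    (ha1 : a < 1) (ha' : a ≤ 1 / 2) (hac : n * (a * (1 + a)) ^ 2 ≤ c) :
    (tree n ha ha1).ContinuousVarianceConstraint c := by
  intro s t hst
  refine ⟨integrable_fairCoins _, ?_⟩
  refine condExp_le_of_forall_setIntegral_le ((tree n ha ha1).history.le s)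
    (integrable_fairCoins _) (integrable_fairCoins _) ?_ fun S hS => ?_
  · have h : StronglyMeasurable[(tree n ha ha1).history s] fun ω => (tree n ha ha1).path ω s :=
      Filtration.stronglyAdapted_natural
        (fun t => ((tree n ha ha1).measurable_eval t).stronglyMeasurable) s
    exact (h.pow 2).const_mul _
  exact setIntegral_tree_variance_le hn ha ha' hac hst fun x y hxy =>
    (tree n ha ha1).mem_iff_of_measurableSet_history hS fun t ht => treePath_congr a ht hxy

/-! ### Returns at grid times and the investor's earnings -/

lemma treePath_succ_div_sub_one {n : ℕ} {a : ℝ} (ha : 0 ≤ a) (ha1 : a < 1) (m : Fin n)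
    (ω : Fin n → Bool) :
    treePath n a ω (gridTime n m.succ) / treePath n a ω (gridTime n m.castSucc) - 1 =
      a * sign (ω m) := by
  have h : treePath n a ω (gridTime n m.succ) =
      treePath n a ω (gridTime n m.castSucc) * (1 + a * sign (ω m)) := by
    rw [treePath_apply, treePath_apply, ← Finset.prod_erase_mul _ _ (Finset.mem_univ m),
      ← Finset.prod_erase_mul _ _ (Finset.mem_univ m), mul_assoc]
    congr 1
    · refine Finset.prod_congr rfl fun i hi => ?_
      have hne : (i : ℕ) ≠ m := fun h => (Finset.mem_erase.1 hi).1 (Fin.ext h)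
      have hiff : (i : ℕ) < m + 1 ↔ (i : ℕ) < m := by omega
      simp only [stepFactor, elapsed_gridTime, Fin.val_succ, Fin.val_castSucc, hiff]
    · simp [stepFactor, elapsed_gridTime]
  rw [h, mul_div_cancel_left₀ _ (treePath_pos ha ha1 ω _).ne']
  ring

lemma tree_ratioConstraint {n : ℕ} {a z : ℝ} (ha : 0 ≤ a) (ha1 : a < 1) (haz : a ≤ z) :
    (tree n ha ha1).RatioConstraint n z := by
  refine ⟨fun m => ae_of_all _ fun ω => treePath_pos ha ha1 ω _, fun m => ae_of_all _ fun ω => ?_⟩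
  have h := treePath_succ_div_sub_one ha ha1 m ω
  refine (congrArg abs h).trans_le ?_
  rcases sign_eq_or (ω m) with h | h <;> rw [h] <;> simpa [abs_of_nonneg ha] using haz

/-- The investor's expected earnings against the binomial tree vanish. -/
lemma loss_tree (g : ℝ → ℝ) {n : ℕ} {a : ℝ} (ha : 0 ≤ a) (ha1 : a < 1) (A : InvestorStrategy n) :
    loss g A (tree n ha ha1) = ((∫ ω, g (treePath n a ω 1) ∂(fairCoins n) : ℝ) : EReal) := by
  refine (extendedExpectation_eq_integral (integrable_fairCoins _)).trans ?_
  change ((∫ ω, (g (treePath n a ω 1) - ∑ m : Fin n,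
    (treePath n a ω (gridTime n m.succ) / treePath n a ω (gridTime n m.castSucc) - 1) *
      A.invest m (treePath n a ω)) ∂(fairCoins n) : ℝ) : EReal) = _
  rw [integral_sub (integrable_fairCoins _) (integrable_fairCoins _),
    integral_finsetSum _ fun _ _ => integrable_fairCoins _, Finset.sum_eq_zero, sub_zero]
  intro m _
  simp_rw [treePath_succ_div_sub_one ha ha1, mul_comm (a * sign _)]
  -- At its own starting time, period `m` has elapsed fraction `0` and does not count as started, so
  -- the investment cannot see coin `m`.
  have hdep : DependsOn (fun ω => A.invest m (treePath n a ω)) ({m}ᶜ : Set (Fin n)) := by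
    intro x y hxy
    refine A.invest_congr m fun t ht => treePath_congr a ht fun i hi => hxy i ?_
    rintro rfl
    rw [mem_started, elapsed_gridTime] at hi
    simp at hi
  rw [integral_mul_coin m hdep fun b => a * sign b]
  simp [sign]

/-! ### Weak convergence of the final log-price -/

/-- The return `q / (1 + q)`, where `q = √(c / n)`, in each period of the binomial tree. -/
def stepSize (c : ℝ) (n : ℕ) : ℝ := √(c / n) / (1 + √(c / n))

lemma stepSize_nonneg (c : ℝ) (n : ℕ) : 0 ≤ stepSize c n := by unfold stepSize; positivity

lemma stepSize_lt_one (c : ℝ) (n : ℕ) : stepSize c n < 1 := by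
  have := Real.sqrt_nonneg (c / n)
  rw [stepSize, div_lt_one (by positivity)]
  linarith

lemma stepSize_le_sqrt (c : ℝ) (n : ℕ) : stepSize c n ≤ √(c / n) :=
  div_le_self (Real.sqrt_nonneg _) (by linarith [Real.sqrt_nonneg (c / n)])

lemma stepSize_le_half {c : ℝ} {n : ℕ} (h : c ≤ n) : stepSize c n ≤ 1 / 2 := by
  have h1 : √(c / n) ≤ 1 := Real.sqrt_le_one.2 (div_le_one_of_le₀ h (by positivity))
  have h0 := Real.sqrt_nonneg (c / n)
  rw [stepSize, div_le_iff₀ (by positivity)]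
  linarith

/-- With `a = q / (1 + q)` one has `a (1 + a) = q (1 + 2 q) / (1 + q)^2 ≤ q`. -/
lemma mul_stepSize_sq_le {c : ℝ} (hc : 0 ≤ c) {n : ℕ} (hn : 0 < n) :
    n * (stepSize c n * (1 + stepSize c n)) ^ 2 ≤ c := by
  have hq := Real.sqrt_nonneg (c / n)
  set q := √(c / n) with hqdef
  have h : stepSize c n * (1 + stepSize c n) ≤ q := by
    have : stepSize c n * (1 + stepSize c n) = q * (1 + 2 * q) / (1 + q) ^ 2 := by
      rw [stepSize, ← hqdef]
      field_simp
      ring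
    rw [this, div_le_iff₀ (by positivity)]
    nlinarith [pow_nonneg hq 3]
  have hn' : (0 : ℝ) < n := by exact_mod_cast hn
  calc n * (stepSize c n * (1 + stepSize c n)) ^ 2 ≤ n * q ^ 2 := by
        have := stepSize_nonneg c n
        gcongr
    _ = c := by
        rw [hqdef, Real.sq_sqrt (by positivity)]
        field_simp

lemma tendsto_sqrt_natCast : Tendsto (fun n : ℕ => √(n : ℝ)) atTop atTop :=
  Real.tendsto_sqrt_atTop.comp tendsto_natCast_atTop_atTop

lemma tendsto_sqrt_mul_stepSize (c : ℝ) :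
    Tendsto (fun n : ℕ => √(n : ℝ) * stepSize c n) atTop (𝓝 √c) := by
  have h1 : Tendsto (fun n : ℕ => √(c / n)) atTop (𝓝 0) := by
    rw [← Real.sqrt_zero]
    exact (Real.continuous_sqrt.tendsto 0).comp (tendsto_const_div_atTop_nhds_zero_nat c)
  have h2 : Tendsto (fun n : ℕ => √c / (1 + √(c / n))) atTop (𝓝 (√c / (1 + 0))) :=
    tendsto_const_nhds.div (h1.const_add 1) (by norm_num)
  rw [add_zero, div_one] at h2
  refine h2.congr' ?_
  filter_upwards [eventually_gt_atTop 0] with n hn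
  have hn' : (0 : ℝ) < n := by exact_mod_cast hn
  rw [stepSize, ← mul_div_assoc, ← Real.sqrt_mul hn'.le, mul_div_cancel₀ _ hn'.ne']

/-- The delta method at `0` for sequences rescaled by `√n`. -/
lemma tendsto_sqrt_mul_comp {f : ℝ → ℝ} {f' l : ℝ} (hf : HasDerivAt f f' 0) (hf0 : f 0 = 0)
    {y : ℕ → ℝ} (hy : Tendsto (fun n : ℕ => √(n : ℝ) * y n) atTop (𝓝 l)) :
    Tendsto (fun n : ℕ => √(n : ℝ) * f (y n)) atTop (𝓝 (l * f')) := by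
  have := hf.hasFDerivAt.hasFDerivWithinAt (s := Set.univ)
  have hy0 : Tendsto y atTop (𝓝 0) := by
    refine (hy.div_atTop tendsto_sqrt_natCast).congr' ?_
    filter_upwards [eventually_gt_atTop 0] with n hn
    have hn' : (0 : ℝ) < n := by exact_mod_cast hn
    exact mul_div_cancel_left₀ _ (Real.sqrt_pos.2 hn').ne'
  have h := this.lim hy0 (by simp) hy
  simpa [hf0] using h

/-- With `d` the mean and `b` half the difference of the two log-returns, the half-sum is `exp(i t
d) cos(t b)`. Here `n d = (n / 2) log(1 - a^2) → -c/2` gives the drift, and `√n b → √c` gives the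
Gaussian factor as the limit of `cos(t b)^n`. -/
lemma tendsto_half_sum_cexp_pow {c : ℝ} (hc : 0 ≤ c) (t : ℝ) :
    Tendsto (fun n : ℕ =>
        ((Complex.exp (t * (Real.log (1 + stepSize c n) : ℝ) * Complex.I) +
          Complex.exp (t * (Real.log (1 - stepSize c n) : ℝ) * Complex.I)) / 2) ^ n) atTop
      (𝓝 (Complex.exp (t * (-c / 2 : ℝ) * Complex.I - c * t ^ 2 / 2))) := by
  have ha := tendsto_sqrt_mul_stepSize c
  have hlog : HasDerivAt (fun x : ℝ => Real.log (1 + x)) 1 0 := by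
    simpa using ((hasDerivAt_id (0 : ℝ)).const_add 1).log (by simp)
  have hlog' : HasDerivAt (fun x : ℝ => Real.log (1 - x)) (-1) 0 := by
    simpa using ((hasDerivAt_id (0 : ℝ)).const_sub 1).log (by simp)
  have hsin : HasDerivAt Real.sin 1 0 := by simpa using Real.hasDerivAt_sin 0
  have hup := tendsto_sqrt_mul_comp hlog (by simp) ha
  have hdown := tendsto_sqrt_mul_comp hlog' (by simp) ha
  set b : ℕ → ℝ := fun n => (Real.log (1 + stepSize c n) - Real.log (1 - stepSize c n)) / 2
    with hb
  set d : ℕ → ℝ := fun n => (Real.log (1 + stepSize c n) + Real.log (1 - stepSize c n)) / 2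
    with hd
  have hblim : Tendsto (fun n : ℕ => √(n : ℝ) * (t * b n / 2)) atTop (𝓝 (t * √c / 2)) := by
    have := ((hup.sub hdown).mul_const (t / 4))
    convert! this using 2
    · simp only [hb]; ring
    · ring
  have hcos : Tendsto (fun n : ℕ => Real.cos (t * b n) ^ n) atTop
      (𝓝 (Real.exp (-(c * t ^ 2 / 2)))) := by
    have h1 : Tendsto (fun n : ℕ => (n : ℝ) * (Real.cos (t * b n) - 1)) atTop
        (𝓝 (-(c * t ^ 2 / 2))) := by
      -- Uses `cos x - 1 = -2 sin^2(x / 2)`.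
      have h2 := ((tendsto_sqrt_mul_comp hsin Real.sin_zero hblim).pow 2).const_mul (-2)
      convert! h2 using 2 with n
      · rw [mul_pow, Real.sq_sqrt (by positivity), Real.sin_sq_eq_half_sub]
        ring_nf
      · rw [mul_one, div_pow, mul_pow, Real.sq_sqrt hc]
        ring
    simpa using Real.tendsto_one_add_pow_exp_of_tendsto h1
  have hdlim : Tendsto (fun n : ℕ => (n : ℝ) * d n) atTop (𝓝 (-c / 2)) := by
    have h1 : Tendsto (fun n : ℕ => (n : ℝ) * -(stepSize c n) ^ 2) atTop (𝓝 (-c)) := by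
      have h2 := (ha.pow 2).neg
      rw [Real.sq_sqrt hc] at h2
      refine h2.congr fun n => ?_
      rw [mul_pow, Real.sq_sqrt (by positivity)]
      ring
    have h3 := (Real.tendsto_nat_mul_log_one_add_of_tendsto h1).div_const 2
    refine h3.congr fun n => ?_
    have hn0 := stepSize_nonneg c n
    have hn1 := stepSize_lt_one c n
    have hlog : Real.log (1 + -stepSize c n ^ 2) =
        Real.log (1 + stepSize c n) + Real.log (1 - stepSize c n) := by
      rw [← Real.log_mul (by linarith) (by linarith)]
      ring_nf
    rw [hlog, hd]
    ring
  have hprod : Tendsto (fun n : ℕ => Complex.exp (t * ((n * d n : ℝ) : ℂ) * Complex.I) *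
      ((Real.cos (t * b n) ^ n : ℝ) : ℂ)) atTop
      (𝓝 (Complex.exp (t * (-c / 2 : ℝ) * Complex.I) *
        ((Real.exp (-(c * t ^ 2 / 2)) : ℝ) : ℂ))) := by
    refine Tendsto.mul ?_ ((Complex.continuous_ofReal.tendsto _).comp hcos)
    have hcont : Continuous fun x : ℝ => Complex.exp (t * (x : ℂ) * Complex.I) := by fun_prop
    exact (hcont.tendsto _).comp hdlim
  convert! hprod using 2 with n
  · have h1 : Real.log (1 + stepSize c n) = d n + b n := by simp only [hb, hd]; ring
    have h2 : Real.log (1 - stepSize c n) = d n - b n := by simp only [hb, hd]; ring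
    have h3 : (Complex.exp (t * ((d n + b n : ℝ) : ℂ) * Complex.I) +
        Complex.exp (t * ((d n - b n : ℝ) : ℂ) * Complex.I)) / 2 =
        Complex.exp (t * (d n : ℂ) * Complex.I) * ((Real.cos (t * b n) : ℝ) : ℂ) := by
      rw [Complex.ofReal_cos, Complex.cos, ← mul_div_assoc, mul_add, ← Complex.exp_add,
        ← Complex.exp_add]
      push_cast
      ring_nf
    rw [h1, h2, h3, mul_pow, ← Complex.exp_nat_mul]
    push_cast
    ring_nf
  · rw [Complex.ofReal_exp, ← Complex.exp_add]
    push_cast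
    ring_nf

lemma log_treePath_one {n : ℕ} {a : ℝ} (ha : 0 ≤ a) (ha1 : a < 1) (ω : Fin n → Bool) :
    Real.log (treePath n a ω 1) = ∑ i, Real.log (1 + a * sign (ω i)) := by
  rw [treePath_apply, Real.log_prod fun i _ => (stepFactor_pos ha ha1 1 i (ω i)).ne']
  simp [stepFactor, elapsed_one]

/-- The law of the logarithm of the final price in the binomial tree. -/
def logPriceLaw (c : ℝ) (n : ℕ) : ProbabilityMeasure ℝ :=
  ⟨(fairCoins n).map fun ω => Real.log (treePath n (stepSize c n) ω 1),
    Measure.isProbabilityMeasure_map (measurable_of_finite _).aemeasurable⟩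

lemma charFun_logPriceLaw (c : ℝ) (n : ℕ) (t : ℝ) :
    charFun (logPriceLaw c n : Measure ℝ) t =
      ((Complex.exp (t * (Real.log (1 + stepSize c n) : ℝ) * Complex.I) +
        Complex.exp (t * (Real.log (1 - stepSize c n) : ℝ) * Complex.I)) / 2) ^ n := by
  have h := integral_mul_prod_coin (n := n) (ψ := fun _ => (1 : ℂ))
    (fun _ b => Complex.exp (t * (Real.log (1 + stepSize c n * sign b) : ℝ) * Complex.I))
    Finset.univ (fun _ _ _ => rfl)
  simp only [one_mul, integral_const, probReal_univ, one_smul, Finset.prod_const,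
    Finset.card_univ, Fintype.card_fin] at h
  rw [charFun_apply_real, logPriceLaw, ProbabilityMeasure.coe_mk,
    integral_map (measurable_of_finite _).aemeasurable (by fun_prop)]
  convert! h using 2
  · ext ω
    rw [log_treePath_one (stepSize_nonneg c n) (stepSize_lt_one c n), ← Complex.exp_sum]
    push_cast
    rw [Finset.mul_sum, Finset.sum_mul]
  · simp [sign, sub_eq_add_neg]

lemma tendsto_logPriceLaw {c : ℝ} (hc : 0 ≤ c) :
    Tendsto (logPriceLaw c) atTop
      (𝓝 (⟨gaussianReal (-c / 2) c.toNNReal, inferInstance⟩ : ProbabilityMeasure ℝ)) := by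
  refine ProbabilityMeasure.tendsto_iff_tendsto_charFun.2 fun t => ?_
  simp_rw [charFun_logPriceLaw]
  rw [ProbabilityMeasure.coe_mk, charFun_gaussianReal, Real.coe_toNNReal c hc]
  exact tendsto_half_sum_cexp_pow hc t

/-! ### From weak convergence to the value of the game -/

/-- A non-integrable `f` has integral `0` by convention, so the price needs no integrability proof.
-/
lemma ofReal_integral_le_lintegral {α : Type*} [MeasurableSpace α] {μ : Measure α} {f : α → ℝ}
    (hf : 0 ≤ f) : ENNReal.ofReal (∫ x, f x ∂μ) ≤ ∫⁻ x, ENNReal.ofReal (f x) ∂μ := by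
  by_cases hi : Integrable f μ
  · exact (ofReal_integral_eq_lintegral_ofReal hi (ae_of_all _ hf)).le
  · simp [integral_undef hi]

lemma hasLaw_log_geometricBrownian {Ω : Type*} [MeasurableSpace Ω] {P : Measure Ω}
    {B : ℝ≥0 → Ω → ℝ} (hB : IsBrownianReal B P) {c : ℝ} (hc : 0 ≤ c) :
    HasLaw (fun ω => √c * B 1 ω - c / 2) (gaussianReal (-c / 2) c.toNNReal) P := by
  have h := gaussianReal_sub_const (gaussianReal_const_mul (hB.hasLaw_eval 1) √c) (c / 2)
  convert! h using 2
  · ring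
  · ext
    simp [Real.sq_sqrt hc, hc]

/-- Only a lower bound is wanted, so the portmanteau inequality on open sets suffices, without
uniform integrability. -/
lemma blackScholesPrice_le_liminf {Ω : Type*} [MeasurableSpace Ω] {P : Measure Ω}
    {B : ℝ≥0 → Ω → ℝ} (hB : IsBrownianReal B P) {c : ℝ} (hc : 0 ≤ c) {g : ℝ → ℝ}
    (hg0 : ∀ x, 0 ≤ x → 0 ≤ g x) (hg : ContinuousOn g (Set.Ici 0)) :
    ENNReal.ofReal (blackScholesPrice P g c B) ≤
      liminf (fun n => ENNReal.ofReal
        (∫ ω, g (treePath n (stepSize c n) ω 1) ∂(fairCoins n))) atTop := by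
  have hcont : Continuous fun y => g (Real.exp y) :=
    hg.comp_continuous Real.continuous_exp fun y => (Real.exp_pos y).le
  have hnonneg : (0 : ℝ → ℝ) ≤ fun y => g (Real.exp y) := fun y => hg0 _ (Real.exp_pos y).le
  have hprice : blackScholesPrice P g c B =
      ∫ y, g (Real.exp y) ∂(gaussianReal (-c / 2) c.toNNReal) := by
    rw [← (hasLaw_log_geometricBrownian hB hc).integral_comp hcont.aestronglyMeasurable]
    simp [blackScholesPrice, geometricBrownian]
  have hlaw (n : ℕ) : ∫⁻ y, ENNReal.ofReal (g (Real.exp y)) ∂(logPriceLaw c n : Measure ℝ) =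
      ENNReal.ofReal (∫ ω, g (treePath n (stepSize c n) ω 1) ∂(fairCoins n)) := by
    have hpos (ω : Fin n → Bool) := treePath_pos (stepSize_nonneg c n) (stepSize_lt_one c n) ω 1
    rw [logPriceLaw, ProbabilityMeasure.coe_mk,
      lintegral_map hcont.measurable.ennreal_ofReal (measurable_of_finite _),
      ofReal_integral_eq_lintegral_ofReal (integrable_fairCoins _)
        (ae_of_all _ fun ω => hg0 _ (hpos ω).le)]
    simp_rw [Real.exp_log (hpos _)]
  rw [hprice]
  refine (ofReal_integral_le_lintegral hnonneg).trans ?_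
  simp_rw [← hlaw]
  exact lintegral_le_liminf_lintegral_of_forall_isOpen_measure_le_liminf_measure hcont hnonneg
    fun G hG => ProbabilityMeasure.le_liminf_measure_open_of_tendsto (tendsto_logPriceLaw hc) hG

lemma le_gameValue {g : ℝ → ℝ} {c : ℝ} (hc : 0 ≤ c) {ζ : ℕ → ℝ} {n : ℕ} (hn : 0 < n)
    (hcn : c ≤ n) (hζ : √(c / n) ≤ ζ n) :
    ((∫ ω, g (treePath n (stepSize c n) ω 1) ∂(fairCoins n) : ℝ) : EReal) ≤
      gameValue g c ζ n := by
  refine le_iInf fun A => ?_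
  rw [← loss_tree g (stepSize_nonneg c n) (stepSize_lt_one c n) A]
  exact le_iSup₂ (f := fun X (_ : X ∈ naturePaths c ζ n) => loss g A X) _
    ⟨tree_continuousVarianceConstraint hn _ _ (stepSize_le_half hcn) (mul_stepSize_sq_le hc hn),
      tree_ratioConstraint _ _ ((stepSize_le_sqrt c n).trans hζ)⟩

lemma eventually_sqrt_le {c : ℝ} (hc : 0 ≤ c) {ζ : ℕ → ℝ} (hζ_pos : ∀ n, 1 ≤ n → 0 < ζ n)
    (hζ_rate : ((16 * c : ℝ) : EReal) <
      liminf (fun n : ℕ => (((n : ℝ) * ζ n ^ 2 / Real.log n : ℝ) : EReal)) atTop) :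
    ∀ᶠ n : ℕ in atTop, √(c / n) ≤ ζ n := by
  -- From `n = 3 > e` on, `log n ≥ 1`, so `n ζ_n^2 > 16 c log n ≥ c`.
  filter_upwards [eventually_lt_of_lt_liminf hζ_rate, eventually_ge_atTop 3] with n hn hn3
  have hn' : (3 : ℝ) ≤ n := by exact_mod_cast hn3
  have hlog : 1 ≤ Real.log n := by
    rw [Real.le_log_iff_exp_le (by linarith)]
    linarith [Real.exp_one_lt_d9]
  rw [EReal.coe_lt_coe_iff, lt_div_iff₀ (by linarith)] at hn
  rw [Real.sqrt_le_left (hζ_pos n (by omega)).le, div_le_iff₀ (by linarith)]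
  nlinarith

end OptionGame

end

theorem mainTheorem4 {Ω : Type*} [MeasurableSpace Ω] (P : Measure Ω) [IsProbabilityMeasure P]
    (B : ℝ≥0 → Ω → ℝ) (hB : IsBrownianReal B P)
    (c : ℝ) (hc : 0 < c)
    (g : ℝ → ℝ) (hg_nonneg : ∀ x, 0 ≤ x → 0 ≤ g x) (hg_convex : ConvexOn ℝ (Set.Ici 0) g)
    (L : ℝ≥0) (hg_lip : LipschitzOnWith L g (Set.Ici 0))
    (ζ : ℕ → ℝ) (hζ_pos : ∀ n, 1 ≤ n → 0 < ζ n) (hζ_lim : Tendsto ζ atTop (𝓝 0))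
    (hζ_rate : ((16 * c : ℝ) : EReal) <
      liminf (fun n : ℕ => (((n : ℝ) * ζ n ^ 2 / Real.log n : ℝ) : EReal)) atTop) :
    ((OptionGame.blackScholesPrice P g c B : ℝ) : EReal) ≤
      liminf (fun n : ℕ => OptionGame.gameValue g c ζ n) atTop := by
  have hnonneg (n : ℕ) : 0 ≤ ∫ ω, g (OptionGame.treePath n (OptionGame.stepSize c n) ω 1)
      ∂(OptionGame.fairCoins n) :=
    integral_nonneg fun ω => hg_nonneg _ (OptionGame.treePath_pos
      (OptionGame.stepSize_nonneg c n) (OptionGame.stepSize_lt_one c n) ω 1).le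
  have hfatou := OptionGame.blackScholesPrice_le_liminf hB hc.le hg_nonneg hg_lip.continuousOn
  refine le_of_forall_lt fun x hx => ?_
  obtain ⟨r, hxr, hr⟩ := EReal.exists_between_coe_real hx
  refine hxr.trans_le (le_liminf_of_le (by isBoundedDefault) ?_)
  have hlow : ∀ᶠ n in atTop, r ≤ ∫ ω, g (OptionGame.treePath n (OptionGame.stepSize c n) ω 1)
      ∂(OptionGame.fairCoins n) := by
    -- `ENNReal.ofReal` truncates at `0`, so negative `r` is handled by the sign of the integral.
    rcases lt_or_ge r 0 with hr0 | hr0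
    · exact .of_forall fun n => hr0.le.trans (hnonneg n)
    · have hlt : ENNReal.ofReal r < ENNReal.ofReal (OptionGame.blackScholesPrice P g c B) :=
        (ENNReal.ofReal_lt_ofReal_iff_of_nonneg hr0).2 (EReal.coe_lt_coe_iff.1 hr)
      filter_upwards [eventually_lt_of_lt_liminf (hlt.trans_le hfatou)] with n hn
      exact ((ENNReal.ofReal_lt_ofReal_iff_of_nonneg hr0).1 hn).le
  filter_upwards [hlow, OptionGame.eventually_sqrt_le hc.le hζ_pos hζ_rate,
    eventually_gt_atTop 0, eventually_ge_atTop ⌈c⌉₊] with n h1 h2 h3 h4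
  exact (EReal.coe_le_coe_iff.2 h1).trans
    (OptionGame.le_gameValue hc.le h3 (Nat.ceil_le.1 h4) h2)
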